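/- Let $H:\mathbb{R}\to\mathbb{R}$ be given by $H(x)=x^2$ for $|x|<1$ and $H(x)=|x|$ for $|x|\ge 1$, and for a real matrix $M$ write $\|M\|_H=\sum_{i,j}H(M_{i,j})$. For $A\in\mathbb{R}^{n\times n}$ and $S\subseteq[n]$ let $A_S\in\mathbb{R}^{n\times|S|}$ be the submatrix of the columns of $A$ indexed by $S$. Theorem. There are matrices $A_n\in\mathbb{R}^{n\times n}$, one for each $n\ge 1$, such that no $o(\sqrt{\log n})$ columns of $A_n$ give an $O(1)$-approximation to the best rank-1 approximation of $A_n$. Precisely: $\min_{\operatorname{rank}(A')\le 1}\|A'-A_n\|_H>0$ for every $n\ge 2$, and for every sequence of nonnegative integers $s(n)=o(\sqrt{\log n})$ there is a function $f:\mathbb{N}\to\mathbb{R}$ with $f(n)\to\infty$ such that for every $n\ge 1$ and every $S\subseteq[n]$ with $|S|\le s(n)$, $$\min_{X\in\mathbb{R}^{|S|\times n}}\|(A_n)_S X-A_n\|_H\ \ge\ f(n)\cdot\min_{\operatorname{rank}(A')\le 1}\|A'-A_n\|_H .$$ -/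

import Mathlib

open Filter Asymptotics

noncomputable section

/-- The modified Huber function with threshold `1`. -/
def huber (x : ℝ) : ℝ := if |x| < 1 then x ^ 2 else |x|

/-- The entrywise error measure `‖M‖_g = ∑ i j, g (M i j)`. -/
def entrywiseError {m n : Type*} [Fintype m] [Fintype n] (g : ℝ → ℝ) (M : Matrix m n ℝ) : ℝ :=
  ∑ i, ∑ j, g (M i j)

/-- `min_{rank-1 A'} ‖A' - A‖_g`, where "rank-1" means, as usual in low rank approximation,
rank at most one. For nonnegative `g` the infimum is over a nonempty set that is bounded below. -/
def bestRankOneError {n : ℕ} (g : ℝ → ℝ) (A : Matrix (Fin n) (Fin n) ℝ) : ℝ :=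
  ⨅ B : {B : Matrix (Fin n) (Fin n) ℝ // B.rank ≤ 1}, entrywiseError g (B.1 - A)

/-- The submatrix `A_S` consisting of the columns of `A` indexed by `S`. -/
def columnSubmatrix {n : ℕ} (A : Matrix (Fin n) (Fin n) ℝ) (S : Finset (Fin n)) :
    Matrix (Fin n) S ℝ :=
  A.submatrix id (fun j : S => (j : Fin n))

/-- `min_{X ∈ ℝ^{|S| × n}} ‖A_S X - A‖_g`. -/
def columnSubsetError {n : ℕ} (g : ℝ → ℝ) (A : Matrix (Fin n) (Fin n) ℝ)
    (S : Finset (Fin n)) : ℝ :=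
  ⨅ X : Matrix S (Fin n) ℝ, entrywiseError g (columnSubmatrix A S * X - A)

end

/-! The matrix has `k ≈ √(log₂ n / 16)` column types. Type `t` has a huge head entry and, in its own
block of rows, entries of size `scale k t / scale k l` for every `l`. Keeping only the head row is a
rank-one approximation; the multiplicities are tuned so that its error is at most `3 * typeCost k`
per type (`mul_huber_scale_div_le`). A selection that misses type `t` must fit its head by selected
types `j`, with normalized coefficients `w j` of sum at least 1/2 (`typeCost_mul_sub_le`). Each `w
j` is seen undamped in rows `(j, t)`, at cost at least `typeCost k * 2 ^ |j - t| * huber (w j)`.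
Spreading the `w j` saves at most a factor of order `∑ 2 ^ (-|j - t|)`, and each `j` contributes at
most 3 to these sums over all `t`. So `s` columns cannot serve `k ≫ s` types cheaply, and the ratio
is at least of order `k / (s + 1)`. -/

/-! ### Lower bounds for the Huber function. -/

section Huber

lemma huber_nonneg (x : ℝ) : 0 ≤ huber x := by
  unfold huber; split_ifs <;> positivity

lemma huber_zero : huber 0 = 0 := by simp [huber]

lemma huber_one : huber 1 = 1 := by simp [huber]

lemma huber_of_one_le_abs {x : ℝ} (h : 1 ≤ |x|) : huber x = |x| := by
  simp [huber, not_lt.2 h]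

lemma huber_of_abs_lt_one {x : ℝ} (h : |x| < 1) : huber x = x ^ 2 := by
  simp [huber, h]

lemma sq_clamp_le_huber (x : ℝ) : (max 0 (min x 1)) ^ 2 ≤ huber x := by
  rcases le_total x 0 with h | h
  · have : max 0 (min x 1) = 0 := by simp [h]
    rw [this]; simpa using huber_nonneg x
  · rcases lt_or_ge x 1 with h1 | h1
    · rw [huber_of_abs_lt_one (by rwa [abs_of_nonneg h]), min_eq_left h1.le, max_eq_right h]
    · rw [huber_of_one_le_abs (by rwa [abs_of_nonneg h]), min_eq_right h1, abs_of_nonneg h]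
      simpa using h1

lemma abs_lt_of_huber_lt {x ε : ℝ} (hε : 0 < ε) (hε1 : ε ≤ 1) (h : huber x < ε ^ 2) :
    |x| < ε := by
  by_cases hx : |x| < 1
  · rw [huber_of_abs_lt_one hx] at h
    exact abs_lt_of_sq_lt_sq h hε.le
  · rw [huber_of_one_le_abs (not_lt.1 hx)] at h
    nlinarith

lemma half_le_sum_clamp {ι : Type*} (T : Finset ι) (w : ι → ℝ) (h : 1 / 2 ≤ ∑ j ∈ T, w j) :
    1 / 2 ≤ ∑ j ∈ T, max 0 (min (w j) 1) := by
  by_cases hw : ∃ j ∈ T, 1 ≤ w j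
  · obtain ⟨j, hj, hj1⟩ := hw
    have := Finset.single_le_sum (f := fun j => max 0 (min (w j) 1))
      (fun i _ => le_max_left _ _) hj
    simp only [min_eq_right hj1] at this
    norm_num at this
    linarith
  · push Not at hw
    refine h.trans (Finset.sum_le_sum fun j hj => ?_)
    rw [min_eq_left (hw j hj).le]
    exact le_max_right _ _

/-- Weighted Cauchy–Schwarz in dual form: `g c² ≥ 2 lam c - lam² / g` for the clamped values `c`.
Being linear in `∑ 1 / g`, it can later be summed over column types with one common `lam`. -/
lemma linear_sub_le_sum_mul_huber {ι : Type*} (T : Finset ι) (w g : ι → ℝ) (lam : ℝ)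
    (hlam : 0 ≤ lam) (hg : ∀ j ∈ T, 0 < g j) (h : 1 / 2 ≤ ∑ j ∈ T, w j) :
    lam - lam ^ 2 * ∑ j ∈ T, (g j)⁻¹ ≤ ∑ j ∈ T, g j * huber (w j) := by
  have h1 := half_le_sum_clamp T w h
  have h2 : ∀ j ∈ T, 2 * lam * max 0 (min (w j) 1) - lam ^ 2 * (g j)⁻¹ ≤ g j * huber (w j) := by
    intro j hj
    have hgj := hg j hj
    refine le_trans ?_ (mul_le_mul_of_nonneg_left (sq_clamp_le_huber (w j)) hgj.le)
    set c := max 0 (min (w j) 1)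
    have : g j * c ^ 2 - (2 * lam * c - lam ^ 2 * (g j)⁻¹) = (g j)⁻¹ * (g j * c - lam) ^ 2 := by
      field_simp; ring
    have h3 : 0 ≤ (g j)⁻¹ * (g j * c - lam) ^ 2 := by positivity
    linarith
  have h3 := Finset.sum_le_sum h2
  rw [Finset.sum_sub_distrib, ← Finset.mul_sum, ← Finset.mul_sum] at h3
  nlinarith

end Huber

/-! ### Basic bounds and positivity of the rank-one error. -/

section EntrywiseError

lemma entrywiseError_huber_nonneg {m n : Type*} [Fintype m] [Fintype n] (M : Matrix m n ℝ) :
    0 ≤ entrywiseError huber M :=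
  Finset.sum_nonneg fun _ _ => Finset.sum_nonneg fun _ _ => huber_nonneg _

lemma huber_entry_le_entrywiseError {m n : Type*} [Fintype m] [Fintype n] (M : Matrix m n ℝ)
    (i : m) (j : n) : huber (M i j) ≤ entrywiseError huber M :=
  (Finset.single_le_sum (f := fun j => huber (M i j)) (fun _ _ => huber_nonneg _)
    (Finset.mem_univ j)).trans
    (Finset.single_le_sum (f := fun i => ∑ j, huber (M i j))
      (fun _ _ => Finset.sum_nonneg fun _ _ => huber_nonneg _) (Finset.mem_univ i))

lemma columnSubsetError_huber_nonneg {n : ℕ} (A : Matrix (Fin n) (Fin n) ℝ)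
    (S : Finset (Fin n)) : 0 ≤ columnSubsetError huber A S :=
  Real.iInf_nonneg fun _ => entrywiseError_huber_nonneg _

lemma bestRankOneError_huber_le {n : ℕ} (A B : Matrix (Fin n) (Fin n) ℝ) (hB : B.rank ≤ 1) :
    bestRankOneError huber A ≤ entrywiseError huber (B - A) :=
  ciInf_le (f := fun B : {B : Matrix (Fin n) (Fin n) ℝ // B.rank ≤ 1} =>
    entrywiseError huber (B.1 - A))
    ⟨0, by rintro _ ⟨B, rfl⟩; exact entrywiseError_huber_nonneg _⟩ ⟨B, hB⟩

lemma Matrix.mul_eq_mul_of_rank_le_one {n : ℕ} (B : Matrix (Fin n) (Fin n) ℝ) (hB : B.rank ≤ 1)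
    (a b c d : Fin n) : B a c * B b d = B a d * B b c := by
  have h1 : (B.submatrix ![a, b] ![c, d]).rank ≤ 1 := (Matrix.rank_submatrix_le _ _ _).trans hB
  have h2 : (B.submatrix ![a, b] ![c, d]).det = 0 := by
    by_contra h
    have := Matrix.rank_of_isUnit _ ((Matrix.isUnit_iff_isUnit_det _).2 (isUnit_iff_ne_zero.2 h))
    rw [Fintype.card_fin] at this
    omega
  rw [Matrix.det_fin_two] at h2
  simp at h2
  linarith

/-- No minimizer is needed: a zero infimum makes `A` an entrywise limit of matrices of rank at most
one, and vanishing of a 2×2 minor is a closed condition. -/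
lemma bestRankOneError_huber_pos {n : ℕ} (A : Matrix (Fin n) (Fin n) ℝ) (a b c d : Fin n)
    (h : A a c * A b d ≠ A a d * A b c) : 0 < bestRankOneError huber A := by
  by_contra hle
  replace hle := not_lt.1 hle
  let K : Set (Matrix (Fin n) (Fin n) ℝ) := {B | B a c * B b d = B a d * B b c}
  have hK : IsClosed K := by
    refine isClosed_eq ?_ ?_ <;> fun_prop
  have hA : A ∈ closure K := by
    have hseq : ∀ m : ℕ, ∃ B ∈ K, ∀ i j, |B i j - A i j| < 1 / ((m : ℝ) + 1) := by
      intro m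
      have hm : (0 : ℝ) < 1 / ((m : ℝ) + 1) := Nat.one_div_pos_of_nat
      have : Nonempty {B : Matrix (Fin n) (Fin n) ℝ // B.rank ≤ 1} := ⟨⟨0, by simp⟩⟩
      obtain ⟨B, hB⟩ := exists_lt_of_ciInf_lt (hle.trans_lt (pow_pos hm 2))
      refine ⟨B.1, Matrix.mul_eq_mul_of_rank_le_one B.1 B.2 a b c d, fun i j => ?_⟩
      refine abs_lt_of_huber_lt hm ?_ ((huber_entry_le_entrywiseError (B.1 - A) i j).trans_lt hB)
      rw [div_le_one (by positivity)]
      linarith [(Nat.cast_nonneg m : (0 : ℝ) ≤ m)]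
    choose B hBK hBA using hseq
    refine mem_closure_of_tendsto (b := atTop) (f := B) ?_ (Eventually.of_forall hBK)
    refine tendsto_pi_nhds.2 fun i => tendsto_pi_nhds.2 fun j => ?_
    rw [tendsto_iff_norm_sub_tendsto_zero]
    exact squeeze_zero (fun _ => norm_nonneg _) (fun m => (hBA m i j).le)
      tendsto_one_div_add_atTop_nhds_zero_nat
  rw [hK.closure_eq] at hA
  exact h hA

end EntrywiseError

/-! ### Rows and columns with prescribed multiplicities. -/

section Labels

lemma exists_labelling {ι : Type*} [Fintype ι] [DecidableEq ι] (m : ι → ℕ) (n : ℕ)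
    (h : ∑ i, m i ≤ n) :
    ∃ f : Fin n → Option ι, ∀ i, (Finset.univ.filter fun r => f r = some i).card = m i := by
  have hc : Fintype.card (Σ i, Fin (m i)) ≤ Fintype.card (Fin n) := by simpa using h
  obtain ⟨e⟩ := Function.Embedding.nonempty_of_card_le hc
  classical
  -- Indices outside the range of `e` get `none`; they become zero padding.
  refine ⟨fun r => (Function.partialInv e r).map Sigma.fst, fun i => ?_⟩
  have : (Finset.univ.filter fun r => (Function.partialInv e r).map Sigma.fst = some i)
      = Finset.univ.image fun x : Fin (m i) => e ⟨i, x⟩ := by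
    ext r
    simp only [Finset.mem_filter, Finset.mem_univ, true_and, Option.map_eq_some_iff,
      Finset.mem_image]
    constructor
    · rintro ⟨⟨i', x⟩, h1, rfl⟩
      exact ⟨x, (Function.Injective.isPartialInv e.injective _ _).1 h1⟩
    · rintro ⟨x, rfl⟩
      exact ⟨⟨i, x⟩, Function.partialInv_left e.injective _, rfl⟩
  rw [this, Finset.card_image_of_injective _ (fun x y hxy => by simpa using hxy)]
  simp

lemma sum_comp_labelling {ι : Type*} [Fintype ι] [DecidableEq ι] {m : ι → ℕ} {n : ℕ}
    {f : Fin n → Option ι} (hf : ∀ i, (Finset.univ.filter fun r => f r = some i).card = m i)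
    (F : Option ι → ℝ) (hF : F none = 0) : ∑ r, F (f r) = ∑ i, (m i : ℝ) * F (some i) := by
  rw [← Finset.sum_fiberwise (s := Finset.univ) (g := f), Fintype.sum_option]
  have h0 : ∑ r with f r = none, F (f r) = 0 :=
    Finset.sum_eq_zero fun r hr => by rw [(Finset.mem_filter.1 hr).2, hF]
  rw [h0, zero_add]
  refine Finset.sum_congr rfl fun i _ => ?_
  rw [Finset.sum_congr rfl (g := fun _ => F (some i))
    (fun r hr => by rw [(Finset.mem_filter.1 hr).2]), Finset.sum_const, hf, nsmul_eq_mul]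

end Labels

/-! ### Multiplicities, scales and the cost of one column type. -/

section Weights

/-- Number of rows carrying the entry of relative size `1 / scale k l` in the block of type `j`. -/
def rowMult (k j l : ℕ) : ℕ := 2 ^ (j ^ 2 + (4 * k + 2 - 2 * j) * l)

/-- Number of columns of type `t`. -/
def colMult (k t : ℕ) : ℕ := 2 ^ ((4 * k + 2) * (k - t) + t ^ 2)

/-- Size of the columns of type `t`. -/
noncomputable def scale (k t : ℕ) : ℝ := 2 ^ ((2 * k + 2) * t)

/-- The common optimal cost carried by the columns of each type, up to a constant factor. -/
noncomputable def typeCost (k : ℕ) : ℝ := 2 ^ ((4 * k + 2) * k)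

/-- Size of the head row relative to the scale of the columns. -/
noncomputable def headSize (k : ℕ) : ℝ := 2 * k * typeCost k

lemma scale_pos (k t : ℕ) : 0 < scale k t := by unfold scale; positivity

lemma one_le_scale (k t : ℕ) : 1 ≤ scale k t := one_le_pow₀ (by norm_num)

lemma typeCost_pos (k : ℕ) : 0 < typeCost k := by unfold typeCost; positivity

lemma one_le_typeCost (k : ℕ) : 1 ≤ typeCost k := one_le_pow₀ (by norm_num)

lemma sum_half_pow_dist_le (k j : ℕ) :
    ∑ t ∈ Finset.range k, (1 / 2 : ℝ) ^ Nat.dist j t ≤ 3 := by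
  have h1 : ∀ m, m ≤ j + 1 →
      (∑ t ∈ Finset.range m, (1 / 2 : ℝ) ^ Nat.dist j t) * 2 ^ j = 2 ^ m - 1 := by
    intro m
    induction m with
    | zero => simp
    | succ m ih =>
      intro hm
      rw [Finset.sum_range_succ, add_mul, ih (by omega)]
      obtain ⟨a, rfl⟩ : ∃ a, j = m + a := ⟨j - m, by omega⟩
      have : Nat.dist (m + a) m = a := by unfold Nat.dist; omega
      rw [this, pow_add, pow_succ]
      have : (1 / 2 : ℝ) ^ a * 2 ^ a = 1 := by rw [← mul_pow]; norm_num
      linear_combination (2 : ℝ) ^ m * this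
  have h2 : ∀ m, ∑ t ∈ Finset.range (j + 1 + m), (1 / 2 : ℝ) ^ Nat.dist j t
      ≤ 3 - (1 / 2) ^ m := by
    intro m
    induction m with
    | zero =>
      have := h1 (j + 1) le_rfl
      have h3 : (0 : ℝ) < 2 ^ j := by positivity
      rw [pow_succ] at this
      simp only [add_zero, pow_zero]
      nlinarith
    | succ m ih =>
      rw [← add_assoc, Finset.sum_range_succ]
      have : Nat.dist j (j + 1 + m) = m + 1 := by unfold Nat.dist; omega
      rw [this, pow_succ]
      linarith
  refine le_trans (Finset.sum_le_sum_of_subset_of_nonneg (t := Finset.range (j + 1 + k)) ?_ ?_)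
    ((h2 k).trans ?_)
  · exact Finset.range_mono (by omega)
  · intros; positivity
  · have : (0 : ℝ) ≤ (1 / 2) ^ k := by positivity
    linarith

lemma sum_fin_half_pow_dist_le (k j : ℕ) : ∑ t : Fin k, (1 / 2 : ℝ) ^ Nat.dist j t ≤ 3 := by
  rw [Fin.sum_univ_eq_sum_range (fun t => (1 / 2 : ℝ) ^ Nat.dist j t)]
  exact sum_half_pow_dist_le k j

/-- The exponents on the right add up to `(4k+2)k + (j-t)²`, and a square dominates the distance. -/
lemma typeCost_mul_le (k j t : ℕ) (hj : j ≤ k) (ht : t ≤ k) :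
    typeCost k * 2 ^ Nat.dist j t ≤ (colMult k t : ℝ) * rowMult k j t := by
  unfold typeCost colMult rowMult
  push_cast
  rw [← pow_add, ← pow_add]
  refine pow_le_pow_right₀ (by norm_num) ?_
  obtain ⟨a, rfl⟩ : ∃ a, k = t + a := ⟨k - t, by omega⟩
  obtain ⟨b, hb⟩ : ∃ b, 4 * (t + a) + 2 = 2 * j + b := ⟨4 * (t + a) + 2 - 2 * j, by omega⟩
  have h1 : 4 * (t + a) + 2 - 2 * j = b := by omega
  have h2 : t + a - t = a := by omega
  rw [h1, h2]
  rcases le_total j t with h | h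
  · obtain ⟨c, rfl⟩ := Nat.exists_eq_add_of_le h
    have : Nat.dist j (j + c) = c := by unfold Nat.dist; omega
    rw [this, hb]
    nlinarith [Nat.le_self_pow (n := 2) (by norm_num) c]
  · obtain ⟨c, rfl⟩ := Nat.exists_eq_add_of_le h
    have : Nat.dist (t + c) t = c := by unfold Nat.dist; omega
    rw [this, hb]
    nlinarith [Nat.le_self_pow (n := 2) (by norm_num) c]

/-- The row multiplicity grows in `l` with exponent slope `4k+2-2t`, strictly between the decay
slopes `2k+2` of the linear regime (`l < t`) and `4k+4` of the quadratic one (`l > t`). The product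
therefore decays geometrically on both sides of `l = t`. -/
lemma mul_huber_scale_div_le (k t l : ℕ) (ht : t < k) :
    (colMult k t : ℝ) * rowMult k t l * huber (scale k t / scale k l)
      ≤ typeCost k * (1 / 2) ^ Nat.dist t l := by
  unfold typeCost colMult rowMult scale
  push_cast
  obtain ⟨a, rfl⟩ : ∃ a, k = t + a + 1 := ⟨k - t - 1, by omega⟩
  have h1 : 4 * (t + a + 1) + 2 - 2 * t = 2 * t + 4 * a + 6 := by omega
  have h2 : t + a + 1 - t = a + 1 := by omega
  rw [h1, h2]
  rcases le_total l t with h | h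
  · obtain ⟨c, rfl⟩ := Nat.exists_eq_add_of_le h
    have hd : Nat.dist (l + c) l = c := by unfold Nat.dist; omega
    have hq : (2 : ℝ) ^ ((2 * (l + c + a + 1) + 2) * (l + c)) / 2 ^ ((2 * (l + c + a + 1) + 2) * l)
        = 2 ^ ((2 * (l + c + a + 1) + 2) * c) := by
      rw [mul_add, pow_add]; field_simp
    have hone : (1 : ℝ) ≤ 2 ^ ((2 * (l + c + a + 1) + 2) * c) := one_le_pow₀ (by norm_num)
    rw [hq, hd, huber_of_one_le_abs (by rwa [abs_of_nonneg (by positivity)]),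
      abs_of_nonneg (by positivity), one_div, inv_pow, ← div_eq_mul_inv, le_div_iff₀ (by positivity),
      ← pow_add, ← pow_add, ← pow_add]
    refine pow_le_pow_right₀ (by norm_num) ?_
    nlinarith
  · obtain ⟨c, rfl⟩ := Nat.exists_eq_add_of_le h
    have hd : Nat.dist t (t + c) = c := by unfold Nat.dist; omega
    have hq : (2 : ℝ) ^ ((2 * (t + a + 1) + 2) * t) / 2 ^ ((2 * (t + a + 1) + 2) * (t + c))
        = (2 ^ ((2 * (t + a + 1) + 2) * c))⁻¹ := by
      rw [mul_add _ t c, pow_add]; field_simp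
    have hub : huber (2 ^ ((2 * (t + a + 1) + 2) * c))⁻¹ =
        ((2 ^ ((2 * (t + a + 1) + 2) * c)) ^ 2)⁻¹ := by
      rcases Nat.eq_zero_or_pos c with rfl | hc
      · simp [huber_one]
      · rw [huber_of_abs_lt_one, inv_pow]
        rw [abs_of_nonneg (by positivity)]
        exact inv_lt_one_of_one_lt₀ (one_lt_pow₀ (by norm_num) (by positivity))
    rw [hq, hub, hd, one_div, inv_pow, ← div_eq_mul_inv, ← div_eq_mul_inv,
      div_le_div_iff₀ (by positivity) (by positivity), ← pow_mul, ← pow_add, ← pow_add, ← pow_add]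
    refine pow_le_pow_right₀ (by norm_num) ?_
    nlinarith

lemma sum_colMult_le (k : ℕ) : ∑ t : Fin k, colMult k t ≤ 2 ^ (16 * k ^ 2) := by
  rcases Nat.eq_zero_or_pos k with rfl | hk
  · simp
  have h : ∀ t ∈ (Finset.univ : Finset (Fin k)), colMult k t ≤ 2 ^ (7 * k ^ 2) := by
    intro t _
    refine Nat.pow_le_pow_right (by norm_num) ?_
    have h1 : (k - (t : ℕ)) ≤ k := Nat.sub_le _ _
    have h2 : (t : ℕ) ^ 2 ≤ k ^ 2 := Nat.pow_le_pow_left t.2.le 2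
    have h3 := Nat.mul_le_mul_left (4 * k + 2) h1
    nlinarith
  refine (Finset.sum_le_card_nsmul _ _ _ h).trans ?_
  rw [Finset.card_univ, Fintype.card_fin, smul_eq_mul]
  calc k * 2 ^ (7 * k ^ 2) ≤ 2 ^ k * 2 ^ (7 * k ^ 2) := Nat.mul_le_mul_right _ Nat.lt_two_pow_self.le
    _ ≤ 2 ^ (16 * k ^ 2) := by
      rw [← pow_add]; exact Nat.pow_le_pow_right (by norm_num) (by nlinarith)

lemma one_add_sum_rowMult_le (k : ℕ) :
    1 + ∑ p : Fin k × Fin k, rowMult k p.1 p.2 ≤ 2 ^ (16 * k ^ 2) := by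
  rcases Nat.eq_zero_or_pos k with rfl | hk
  · simp
  have h : ∀ p ∈ (Finset.univ : Finset (Fin k × Fin k)), rowMult k p.1 p.2 ≤ 2 ^ (7 * k ^ 2) := by
    intro p _
    refine Nat.pow_le_pow_right (by norm_num) ?_
    have h2 : (p.1 : ℕ) ^ 2 ≤ k ^ 2 := Nat.pow_le_pow_left p.1.2.le 2
    have h3 := Nat.mul_le_mul (Nat.sub_le (4 * k + 2) (2 * (p.1 : ℕ))) p.2.2.le
    nlinarith
  refine (Nat.add_le_add_left (Finset.sum_le_card_nsmul _ _ _ h) 1).trans ?_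
  rw [Finset.card_univ, Fintype.card_prod, Fintype.card_fin, smul_eq_mul]
  have hk2 : k < 2 ^ k := Nat.lt_two_pow_self
  have h1 : 1 + k * k * 2 ^ (7 * k ^ 2) ≤ 2 ^ 1 * (2 ^ k * 2 ^ k * 2 ^ (7 * k ^ 2)) := by
    have := Nat.mul_le_mul_right (2 ^ (7 * k ^ 2)) (Nat.mul_le_mul hk2.le hk2.le)
    have h5 : 0 < 2 ^ k * 2 ^ k * 2 ^ (7 * k ^ 2) := by positivity
    omega
  refine h1.trans ?_
  rw [← pow_add, ← pow_add, ← pow_add]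
  exact Nat.pow_le_pow_right (by norm_num) (by nlinarith)

lemma typeCost_mul_sub_le {k : ℕ} (T : Finset (Fin k)) (t : Fin k) (w : Fin k → ℝ) (lam : ℝ)
    (h0 : 0 ≤ lam) (hk : lam ≤ k) :
    typeCost k * (lam - lam ^ 2 * ∑ j ∈ T, (1 / 2 : ℝ) ^ Nat.dist j t) ≤
      colMult k t * (huber (headSize k * scale k t * (∑ j ∈ T, w j - 1)) +
        ∑ j ∈ T, rowMult k j t * huber (w j)) := by
  have hE := typeCost_pos k
  have hE1 := one_le_typeCost k
  have hc : (1 : ℝ) ≤ colMult k t := by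
    unfold colMult; exact_mod_cast Nat.one_le_two_pow
  have hS : 0 ≤ ∑ j ∈ T, rowMult k j t * huber (w j) :=
    Finset.sum_nonneg fun j _ => mul_nonneg (Nat.cast_nonneg _) (huber_nonneg _)
  have hD : 0 ≤ ∑ j ∈ T, (1 / 2 : ℝ) ^ Nat.dist j t := Finset.sum_nonneg fun _ _ => by positivity
  by_cases hw : 1 / 2 ≤ ∑ j ∈ T, w j
  · have h1 := linear_sub_le_sum_mul_huber T w (fun j => 2 ^ Nat.dist j t) lam h0
      (fun _ _ => by positivity) hw
    calc _ = typeCost k * (lam - lam ^ 2 * ∑ j ∈ T, ((2 : ℝ) ^ Nat.dist j t)⁻¹) := by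
          simp [one_div, inv_pow]
      _ ≤ typeCost k * ∑ j ∈ T, 2 ^ Nat.dist j t * huber (w j) :=
          mul_le_mul_of_nonneg_left h1 hE.le
      _ = ∑ j ∈ T, typeCost k * 2 ^ Nat.dist j t * huber (w j) := by
          rw [Finset.mul_sum]; simp only [mul_assoc]
      _ ≤ ∑ j ∈ T, colMult k t * rowMult k j t * huber (w j) :=
          Finset.sum_le_sum fun j _ => mul_le_mul_of_nonneg_right
            (typeCost_mul_le k j t j.2.le t.2.le) (huber_nonneg _)
      _ = colMult k t * ∑ j ∈ T, rowMult k j t * huber (w j) := by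
          rw [Finset.mul_sum]; simp only [mul_assoc]
      _ ≤ _ := mul_le_mul_of_nonneg_left (le_add_of_nonneg_left (huber_nonneg _)) (by positivity)
  -- The head is missed by a relative error above 1/2, which costs `k * typeCost k` already; this is
  -- where `lam ≤ k` suffices.
  · push Not at hw
    have hk1 : (1 : ℝ) ≤ k := by exact_mod_cast (show 1 ≤ k by have := t.2; omega)
    have hs := one_le_scale k t
    have hL : k * typeCost k ≤ |headSize k * scale k t * (∑ j ∈ T, w j - 1)| := by
      rw [abs_mul, abs_of_nonneg (by unfold headSize; positivity), abs_of_neg (by linarith)]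
      unfold headSize
      have : 1 / 2 ≤ scale k t * (-(∑ j ∈ T, w j - 1)) := by nlinarith
      have h2 : (0 : ℝ) ≤ k * typeCost k := by positivity
      nlinarith
    have hone : (1 : ℝ) ≤ k * typeCost k := by nlinarith
    have hH := huber_of_one_le_abs (hone.trans hL)
    have h3 : k * typeCost k ≤ huber (headSize k * scale k t * (∑ j ∈ T, w j - 1)) := by
      rw [hH]; exact hL
    have h4 : typeCost k * (lam - lam ^ 2 * ∑ j ∈ T, (1 / 2 : ℝ) ^ Nat.dist j t)
        ≤ k * typeCost k := by
      have : 0 ≤ lam ^ 2 * ∑ j ∈ T, (1 / 2 : ℝ) ^ Nat.dist j t := by positivity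
      nlinarith
    nlinarith

end Weights

/-! ### The hard matrix and its two error bounds. -/

section Matrix

/-- Entry of the hard matrix as a function of the labels of its row and of its column. -/
noncomputable def labelEntry (k : ℕ) : Option (Option (Fin k × Fin k)) → Option (Fin k) → ℝ
  | none, _ => 0
  | some none, o => ∑ j, if o = some j then headSize k * scale k j else 0
  | some (some p), o => if o = some p.1 then scale k p.1 / scale k p.2 else 0

/-- Multiplicity of each row label. -/
def rowLabelMult (k : ℕ) : Option (Fin k × Fin k) → ℕ
  | none => 1
  | some p => rowMult k p.1 p.2

lemma labelEntry_none (k : ℕ) (l : Option (Option (Fin k × Fin k))) : labelEntry k l none = 0 := by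
  rcases l with _ | _ | p <;> simp [labelEntry]

lemma labelEntry_head_some (k : ℕ) (t : Fin k) :
    labelEntry k (some none) (some t) = headSize k * scale k t := by
  simp [labelEntry]

variable {k n : ℕ} {rho : Fin n → Option (Option (Fin k × Fin k))} {gam : Fin n → Option (Fin k)}

lemma bestRankOneError_label_le
    (hrho : ∀ i, (Finset.univ.filter fun r => rho r = some i).card = rowLabelMult k i)
    (hgam : ∀ i, (Finset.univ.filter fun c => gam c = some i).card = colMult k i) :
    bestRankOneError huber (Matrix.of fun r c => labelEntry k (rho r) (gam c)) ≤
      3 * k * typeCost k := by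
  -- `B` reproduces the head row and vanishes elsewhere.
  let B : Matrix (Fin n) (Fin n) ℝ :=
    Matrix.vecMulVec (fun r => if rho r = some none then 1 else 0)
      (fun c => labelEntry k (some none) (gam c))
  refine (bestRankOneError_huber_le _ B (Matrix.rank_vecMulVec_le _ _)).trans ?_
  let F : Option (Option (Fin k × Fin k)) → Option (Fin k) → ℝ := fun l o =>
    huber ((if l = some none then 1 else 0) * labelEntry k (some none) o - labelEntry k l o)
  have hF : entrywiseError huber (B - Matrix.of fun r c => labelEntry k (rho r) (gam c))
      = ∑ c, ∑ r, F (rho r) (gam c) := by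
    unfold entrywiseError
    rw [Finset.sum_comm]
    rfl
  rw [hF, sum_comp_labelling hgam (fun o => ∑ r, F (rho r) o)
    (by simp [F, labelEntry_none, huber_zero])]
  have hrow : ∀ t : Fin k, colMult k t * ∑ r, F (rho r) (some t) ≤ 3 * typeCost k := by
    intro t
    rw [sum_comp_labelling hrho (fun l => F l (some t)) (by simp [F, labelEntry, huber_zero]),
      Fintype.sum_option, Fintype.sum_prod_type, Finset.sum_eq_single t]
    · have h1 : ∀ l : Fin k, colMult k t * ((rowLabelMult k (some (t, l)) : ℝ) *
          F (some (some (t, l))) (some t)) ≤ typeCost k * (1 / 2) ^ Nat.dist t l := by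
        intro l
        refine le_trans (le_of_eq ?_) (mul_huber_scale_div_le k t l t.2)
        have : F (some (some (t, l))) (some t) = huber (scale k t / scale k l) := by
          simp [F, labelEntry, huber, abs_neg]
        rw [this, ← mul_assoc]; rfl
      have h2 := Finset.sum_le_sum fun l (_ : l ∈ Finset.univ) => h1 l
      rw [← Finset.mul_sum, ← Finset.mul_sum] at h2
      have h3 : F (some none) (some t) = 0 := by simp [F, huber_zero]
      rw [h3, mul_zero, zero_add]
      have h4 := mul_le_mul_of_nonneg_left (sum_fin_half_pow_dist_le k t) (typeCost_pos k).le
      linarith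
    · intro j _ hj
      refine Finset.sum_eq_zero fun l _ => ?_
      have : F (some (some (j, l))) (some t) = 0 := by
        simp [F, labelEntry, Ne.symm hj, huber_zero]
      rw [this, mul_zero]
    · simp
  refine (Finset.sum_le_sum fun t _ => hrow t).trans ?_
  simp
  linarith

lemma typeCost_mul_sub_le_column_error
    (hrho : ∀ i, (Finset.univ.filter fun r => rho r = some i).card = rowLabelMult k i)
    (S : Finset (Fin n)) (x : S → ℝ) (t : Fin k) (ht : t ∉ Finset.eraseNone (S.image gam))
    (lam : ℝ) (h0 : 0 ≤ lam) (hk : lam ≤ k) :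
    typeCost k * (lam - lam ^ 2 * ∑ j ∈ Finset.eraseNone (S.image gam),
        (1 / 2 : ℝ) ^ Nat.dist j t) ≤
      colMult k t * ∑ r, huber (∑ i : S, labelEntry k (rho r) (gam i) * x i -
        labelEntry k (rho r) (some t)) := by
  set T := Finset.eraseNone (S.image gam) with hT
  -- Columns of one type coincide, so only the total coefficient per type matters; `w` rescales it
  -- so that a perfect head fit means `∑ w = 1`.
  let y : Fin k → ℝ := fun j => ∑ i : S, if gam i = some j then x i else 0
  let w : Fin k → ℝ := fun j => y j * scale k j / scale k t
  have hy : ∀ j, j ∉ T → y j = 0 := by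
    intro j hj
    refine Finset.sum_eq_zero fun i _ => if_neg fun h => hj ?_
    rw [hT, Finset.mem_eraseNone]
    exact Finset.mem_image.2 ⟨i, i.2, h⟩
  have hst := scale_pos k t
  refine (typeCost_mul_sub_le T t w lam h0 hk).trans
    (mul_le_mul_of_nonneg_left ?_ (Nat.cast_nonneg _))
  rw [sum_comp_labelling hrho (fun l => huber (∑ i : S, labelEntry k l (gam i) * x i -
        labelEntry k l (some t))) (by simp [labelEntry, huber_zero]), Fintype.sum_option]
  have hhead : ∑ i : S, labelEntry k (some none) (gam i) * x i - labelEntry k (some none) (some t)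
      = headSize k * scale k t * (∑ j ∈ T, w j - 1) := by
    have h1 : ∑ i : S, labelEntry k (some none) (gam i) * x i
        = ∑ j, headSize k * scale k t * w j := by
      simp only [labelEntry, Finset.sum_mul]
      rw [Finset.sum_comm]
      refine Finset.sum_congr rfl fun j _ => ?_
      have : headSize k * scale k t * w j = headSize k * scale k j * y j := by
        simp only [w]; field_simp
      rw [this, Finset.mul_sum]
      refine Finset.sum_congr rfl fun i _ => ?_
      split_ifs <;> simp
    have h2 : ∑ j ∈ T, w j = ∑ j, w j :=
      Finset.sum_subset (Finset.subset_univ _) fun j _ hj => by simp [w, hy j hj]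
    rw [h1, labelEntry_head_some, ← Finset.mul_sum, h2]
    ring
  have hblock : ∀ j ∈ T, ∑ i : S, labelEntry k (some (some (j, t))) (gam i) * x i -
      labelEntry k (some (some (j, t))) (some t) = w j := by
    intro j hj
    have hjt : t ≠ j := fun h => ht (h ▸ hj)
    simp only [labelEntry, w, y, Option.some.injEq, hjt, if_false, sub_zero, Finset.sum_mul,
      Finset.sum_div]
    refine Finset.sum_congr rfl fun i _ => ?_
    split_ifs
    · ring
    · simp
  refine add_le_add (by rw [hhead]; simp [rowLabelMult]) ?_
  rw [Fintype.sum_prod_type]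
  refine (Finset.sum_le_sum fun j hj => ?_).trans (Finset.sum_le_sum_of_subset_of_nonneg
    (Finset.subset_univ T) fun j _ _ => Finset.sum_nonneg fun l _ =>
      mul_nonneg (Nat.cast_nonneg _) (huber_nonneg _))
  rw [← hblock j hj]
  -- Only the rows `l = t` are kept: there the type-`j` entry times `y j` is exactly `w j`.
  exact Finset.single_le_sum (f := fun l : Fin k => (rowLabelMult k (some (j, l)) : ℝ) *
    huber (∑ i : S, labelEntry k (some (some (j, l))) (gam i) * x i -
      labelEntry k (some (some (j, l))) (some t)))
    (fun l _ => mul_nonneg (Nat.cast_nonneg _) (huber_nonneg _)) (Finset.mem_univ t)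

lemma le_columnSubsetError_label
    (hrho : ∀ i, (Finset.univ.filter fun r => rho r = some i).card = rowLabelMult k i)
    (hgam : ∀ i, (Finset.univ.filter fun c => gam c = some i).card = colMult k i)
    (S : Finset (Fin n)) (lam : ℝ) (h0 : 0 ≤ lam) (hk : lam ≤ k) :
    typeCost k * (lam * (k - S.card) - 3 * lam ^ 2 * S.card) ≤
      columnSubsetError huber (Matrix.of fun r c => labelEntry k (rho r) (gam c)) S := by
  refine le_ciInf fun X => ?_
  set T := Finset.eraseNone (S.image gam) with hT
  have hTS : T.card ≤ S.card := (Finset.card_eraseNone_le _).trans Finset.card_image_le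
  have hcol : ∀ c t, gam c = some t → t ∉ T →
      typeCost k * (lam - lam ^ 2 * ∑ j ∈ T, (1 / 2 : ℝ) ^ Nat.dist j t) / colMult k t ≤
      ∑ r, huber ((columnSubmatrix (Matrix.of fun r c => labelEntry k (rho r) (gam c)) S * X -
        Matrix.of fun r c => labelEntry k (rho r) (gam c)) r c) := by
    intro c t hc ht
    have hpos : (0 : ℝ) < colMult k t := by unfold colMult; positivity
    rw [div_le_iff₀' hpos]
    have := typeCost_mul_sub_le_column_error hrho S (fun i => X i c) t ht lam h0 hk
    simpa [Matrix.mul_apply, columnSubmatrix, hc] using this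
  unfold entrywiseError
  rw [Finset.sum_comm]
  let b : Option (Fin k) → ℝ := fun o => o.elim 0 fun t => if t ∈ T then 0 else
    typeCost k * (lam - lam ^ 2 * ∑ j ∈ T, (1 / 2 : ℝ) ^ Nat.dist j t) / colMult k t
  have hb : ∀ c ∈ (Finset.univ : Finset (Fin n)), b (gam c) ≤
      ∑ r, huber ((columnSubmatrix (Matrix.of fun r c => labelEntry k (rho r) (gam c)) S * X -
        Matrix.of fun r c => labelEntry k (rho r) (gam c)) r c) := by
    intro c _
    have hnn : 0 ≤ ∑ r, huber ((columnSubmatrix (Matrix.of fun r c => labelEntry k (rho r) (gam c))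
        S * X - Matrix.of fun r c => labelEntry k (rho r) (gam c)) r c) :=
      Finset.sum_nonneg fun _ _ => huber_nonneg _
    rcases hc : gam c with _ | t
    · exact hnn
    · by_cases ht : t ∈ T
      · simpa [b, ht] using hnn
      · simpa only [b, ht, Option.elim, if_false] using hcol c t hc ht
  refine le_trans ?_ (Finset.sum_le_sum hb)
  rw [sum_comp_labelling hgam b rfl]
  have hterm : ∀ t : Fin k, (colMult k t : ℝ) * b (some t) = if t ∈ T then 0 else
      typeCost k * (lam - lam ^ 2 * ∑ j ∈ T, (1 / 2 : ℝ) ^ Nat.dist j t) := by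
    intro t
    have hpos : (0 : ℝ) < colMult k t := by unfold colMult; positivity
    simp only [b, Option.elim]
    split_ifs
    · simp
    · field_simp
  -- Types in `T` receive a nonpositive bound, so that the double sum runs over all `t` and can be
  -- exchanged.
  have hge : ∀ t ∈ (Finset.univ : Finset (Fin k)), typeCost k * ((if t ∈ T then 0 else lam) -
      lam ^ 2 * ∑ j ∈ T, (1 / 2 : ℝ) ^ Nat.dist j t) ≤ (colMult k t : ℝ) * b (some t) := by
    intro t _
    rw [hterm]
    split_ifs
    · have : 0 ≤ ∑ j ∈ T, (1 / 2 : ℝ) ^ Nat.dist j t := Finset.sum_nonneg fun _ _ => by positivity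
      have h2 : 0 ≤ typeCost k * (lam ^ 2 * ∑ j ∈ T, (1 / 2 : ℝ) ^ Nat.dist j t) :=
        mul_nonneg (typeCost_pos k).le (by positivity)
      linarith
    · exact le_rfl
  refine le_trans ?_ (Finset.sum_le_sum hge)
  rw [← Finset.mul_sum, Finset.sum_sub_distrib, ← Finset.mul_sum, Finset.sum_comm]
  refine mul_le_mul_of_nonneg_left ?_ (typeCost_pos k).le
  have h1 : ∑ t : Fin k, (if t ∈ T then 0 else lam) = lam * (k - T.card) := by
    have : ∀ t : Fin k, (if t ∈ T then 0 else lam) = lam - if t ∈ T then lam else 0 := by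
      intro t; split_ifs <;> simp
    simp only [this, Finset.sum_sub_distrib, Finset.sum_ite_mem, Finset.univ_inter,
      Finset.sum_const, Finset.card_univ, Fintype.card_fin, nsmul_eq_mul]
    ring
  have h2 : ∑ j ∈ T, ∑ t : Fin k, (1 / 2 : ℝ) ^ Nat.dist j t ≤ T.card * 3 := by
    rw [← nsmul_eq_mul]
    exact Finset.sum_le_card_nsmul _ _ _ fun j _ => sum_fin_half_pow_dist_le k j
  have h3 : (T.card : ℝ) ≤ S.card := by exact_mod_cast hTS
  rw [h1]
  have h4 : lam ^ 2 * ∑ j ∈ T, ∑ t : Fin k, (1 / 2 : ℝ) ^ Nat.dist j t ≤ lam ^ 2 * (S.card * 3) :=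
    mul_le_mul_of_nonneg_left (by linarith) (by positivity)
  have h5 : lam * (k - S.card) ≤ lam * (k - T.card) :=
    mul_le_mul_of_nonneg_left (by linarith) h0
  linarith

lemma bestRankOneError_label_pos (hk : 2 ≤ k)
    (hrho : ∀ i, (Finset.univ.filter fun r => rho r = some i).card = rowLabelMult k i)
    (hgam : ∀ i, (Finset.univ.filter fun c => gam c = some i).card = colMult k i) :
    0 < bestRankOneError huber (Matrix.of fun r c => labelEntry k (rho r) (gam c)) := by
  have hr : ∀ p : Fin k × Fin k, ∃ r, rho r = some (some p) := by
    intro p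
    have : 0 < (Finset.univ.filter fun r => rho r = some (some p)).card := by
      rw [hrho]; simp only [rowLabelMult, rowMult]; positivity
    obtain ⟨r, hr⟩ := Finset.card_pos.1 this
    exact ⟨r, (Finset.mem_filter.1 hr).2⟩
  have hc : ∀ t : Fin k, ∃ c, gam c = some t := by
    intro t
    have : 0 < (Finset.univ.filter fun c => gam c = some t).card := by
      rw [hgam]; simp only [colMult]; positivity
    obtain ⟨c, hc⟩ := Finset.card_pos.1 this
    exact ⟨c, (Finset.mem_filter.1 hc).2⟩
  let t0 : Fin k := ⟨0, by omega⟩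
  let t1 : Fin k := ⟨1, by omega⟩
  have h01 : t0 ≠ t1 := by simp [t0, t1]
  obtain ⟨a, ha⟩ := hr (t0, t0)
  obtain ⟨b, hb⟩ := hr (t1, t1)
  obtain ⟨c, hc0⟩ := hc t0
  obtain ⟨d, hd0⟩ := hc t1
  refine bestRankOneError_huber_pos _ a b c d ?_
  simp [ha, hb, hc0, hd0, labelEntry, h01, h01.symm, (scale_pos k _).ne']

end Matrix

/-! ### Choice of the number of types, and asymptotics. -/

section Parameters

/-- Number of column types of the hard matrix of size `n`. -/
def numTypes (n : ℕ) : ℕ := Nat.sqrt (Nat.log 2 n / 16)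

lemma two_pow_numTypes_le (n : ℕ) (hn : n ≠ 0) : 2 ^ (16 * numTypes n ^ 2) ≤ n := by
  refine (Nat.pow_le_pow_right (by norm_num) ?_).trans (Nat.pow_log_le_self 2 hn)
  have := Nat.sqrt_le' (Nat.log 2 n / 16)
  unfold numTypes
  omega

lemma sqrt_log_le_numTypes (n : ℕ) : √(Real.log n) ≤ 4 * (numTypes n + 1) := by
  rcases Nat.eq_zero_or_pos n with rfl | hn
  · simp; positivity
  rw [Real.sqrt_le_left (by positivity)]
  have h1 : Nat.log 2 n / 16 < (numTypes n + 1) ^ 2 := Nat.lt_succ_sqrt' _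
  have h2 : Nat.log 2 n + 1 ≤ 16 * (numTypes n + 1) ^ 2 := by omega
  have h3 : (n : ℝ) ≤ 2 ^ (Nat.log 2 n + 1) := by
    exact_mod_cast (Nat.lt_pow_succ_log_self (by norm_num) n).le
  have h4 := Real.log_le_log (by exact_mod_cast hn) h3
  rw [Real.log_pow] at h4
  have h2' : ((Nat.log 2 n + 1 : ℕ) : ℝ) ≤ 16 * ((numTypes n : ℝ) + 1) ^ 2 := by exact_mod_cast h2
  have h7 := mul_le_mul_of_nonneg_right h2' (Real.log_nonneg one_le_two)
  have h5 : Real.log 2 ≤ 1 := by linarith [Real.log_two_lt_d9]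
  have h6 : (0 : ℝ) ≤ 16 * ((numTypes n : ℝ) + 1) ^ 2 := by positivity
  nlinarith

lemma tendsto_numTypes : Tendsto (fun n => (numTypes n : ℝ)) atTop atTop := by
  have h1 : Tendsto (fun n : ℕ => √(Real.log n)) atTop atTop :=
    Real.tendsto_sqrt_atTop.comp (Real.tendsto_log_atTop.comp tendsto_natCast_atTop_atTop)
  have h2 : Tendsto (fun n : ℕ => √(Real.log n) / 4 - 1) atTop atTop :=
    tendsto_atTop_add_const_right _ _ (h1.atTop_div_const (by norm_num))
  exact tendsto_atTop_mono (fun n => by linarith [sqrt_log_le_numTypes n]) h2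

lemma eventually_mul_le_numTypes (s : ℕ → ℕ)
    (hs : (fun n : ℕ => (s n : ℝ)) =o[atTop] (fun n : ℕ => √(Real.log (n : ℝ)))) (C : ℝ)
    (hC : 0 < C) : ∀ᶠ n in atTop, C * ((s n : ℝ) + 1) ≤ numTypes n := by
  have h1 := hs.def (show (0 : ℝ) < 1 / (8 * C) by positivity)
  filter_upwards [h1, tendsto_numTypes.eventually_ge_atTop (2 * C + 1)] with n h2 h3
  rw [Real.norm_of_nonneg (by positivity), Real.norm_of_nonneg (by positivity)] at h2
  have h4 := sqrt_log_le_numTypes n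
  have h5 : C * s n ≤ √(Real.log n) / 8 := by
    have := mul_le_mul_of_nonneg_left h2 hC.le
    have h6 : C * (1 / (8 * C) * √(Real.log n)) = √(Real.log n) / 8 := by field_simp
    linarith
  linarith

lemma exists_hard_matrix (n : ℕ) : ∃ A : Matrix (Fin n) (Fin n) ℝ,
    (2 ≤ n → 0 < bestRankOneError huber A) ∧
    (2 ≤ numTypes n →
      bestRankOneError huber A ≤ 3 * numTypes n * typeCost (numTypes n) ∧
      ∀ S : Finset (Fin n), ∀ lam : ℝ, 0 ≤ lam → lam ≤ numTypes n →
        typeCost (numTypes n) * (lam * (numTypes n - S.card) - 3 * lam ^ 2 * S.card) ≤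
          columnSubsetError huber A S) := by
  by_cases hk : 2 ≤ numTypes n
  · have hn : n ≠ 0 := by
      rintro rfl
      simp [numTypes] at hk
    have hle := two_pow_numTypes_le n hn
    obtain ⟨rho, hrho⟩ := exists_labelling (rowLabelMult (numTypes n)) n (by
      rw [Fintype.sum_option]
      exact (one_add_sum_rowMult_le _).trans hle)
    obtain ⟨gam, hgam⟩ := exists_labelling (fun t : Fin (numTypes n) => colMult (numTypes n) t) n
      ((sum_colMult_le _).trans hle)
    exact ⟨Matrix.of fun r c => labelEntry (numTypes n) (rho r) (gam c),
      fun _ => bestRankOneError_label_pos hk hrho hgam,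
      fun _ => ⟨bestRankOneError_label_le hrho hgam,
        fun S lam h0 h1 => le_columnSubsetError_label hrho hgam S lam h0 h1⟩⟩
  -- With fewer than two types, the identity matrix still has positive error.
  · refine ⟨1, fun hn => ?_, fun h => absurd h hk⟩
    have h01 : (⟨0, by omega⟩ : Fin n) ≠ ⟨1, by omega⟩ := by simp
    refine bestRankOneError_huber_pos _ ⟨0, by omega⟩ ⟨1, by omega⟩ ⟨0, by omega⟩ ⟨1, by omega⟩ ?_
    simp [Matrix.one_apply_ne h01, Matrix.one_apply_ne h01.symm]

end Parameters

theorem mainTheorem2 :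
    ∃ A : (n : ℕ) → Matrix (Fin n) (Fin n) ℝ,
      (∀ n : ℕ, 2 ≤ n → 0 < bestRankOneError huber (A n)) ∧
      ∀ s : ℕ → ℕ,
        (fun n : ℕ => (s n : ℝ)) =o[atTop] (fun n : ℕ => Real.sqrt (Real.log (n : ℝ))) →
        ∃ f : ℕ → ℝ, Tendsto f atTop atTop ∧
          ∀ n : ℕ, 1 ≤ n → ∀ S : Finset (Fin n), S.card ≤ s n →
            f n * bestRankOneError huber (A n) ≤ columnSubsetError huber (A n) S := by
  choose A hpos hA using exists_hard_matrix
  refine ⟨A, hpos, fun s hs => ?_⟩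
  -- The value 0 is used only for finitely many `n`, since `s = o(√log n)`.
  refine ⟨fun n : ℕ => if 2 * ((s n : ℝ) + 1) ≤ numTypes n then
    (numTypes n : ℝ) / (144 * ((s n : ℝ) + 1)) else 0, ?_, fun n _ S hS => ?_⟩
  · rw [tendsto_atTop]
    intro b
    filter_upwards [eventually_mul_le_numTypes s hs 2 (by norm_num),
      eventually_mul_le_numTypes s hs (144 * (|b| + 1)) (by positivity)] with n h1 h2
    rw [if_pos h1, le_div_iff₀ (by positivity)]
    have h3 := le_abs_self b
    have h4 : (0 : ℝ) ≤ s n := Nat.cast_nonneg _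
    nlinarith
  · dsimp only
    split_ifs with h
    · have h4 : (0 : ℝ) ≤ s n := Nat.cast_nonneg _
      have hk2 : 2 ≤ numTypes n := by
        have : (2 : ℝ) ≤ numTypes n := by linarith
        exact_mod_cast this
      obtain ⟨hup, hlow⟩ := hA n hk2
      have hSs : (S.card : ℝ) ≤ s n := by exact_mod_cast hS
      set k := (numTypes n : ℝ)
      set E := typeCost (numTypes n)
      have hE : 0 < E := typeCost_pos _
      have hk0 : 0 < k := by linarith
      -- This makes `3 * lam * |S| ≤ k / 4`; with `|S| ≤ k / 2` a gain of `lam * k / 4` remains.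
      -- Divided by the upper bound `3 * k`, it gives the ratio `lam / 12`.
      let lam : ℝ := k / (12 * ((s n : ℝ) + 1))
      have hlam : lam * (12 * ((s n : ℝ) + 1)) = k := div_mul_cancel₀ _ (by positivity)
      have hl0 : 0 < lam := by positivity
      have hl1 : lam ≤ k := div_le_self hk0.le (by linarith)
      refine le_trans ?_ (hlow S lam hl0.le hl1)
      have hf : k / (144 * ((s n : ℝ) + 1)) = lam / 12 := by
        simp only [lam]; field_simp; norm_num
      rw [hf]
      refine (mul_le_mul_of_nonneg_left hup (by positivity)).trans ?_
      have h5 : lam * (k / 4) ≤ lam * (k - S.card) - 3 * lam ^ 2 * S.card := by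
        have h6 : 3 * lam * S.card ≤ k / 4 := by nlinarith
        have h7 : k / 4 ≤ k - S.card - 3 * lam * S.card := by linarith
        have := mul_le_mul_of_nonneg_left h7 hl0.le
        linarith
      have := mul_le_mul_of_nonneg_left h5 hE.le
      linarith
    · rw [zero_mul]
      exact columnSubsetError_huber_nonneg _ _
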